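/- Let $G$ be a directed graph, not necessarily finite or acyclic (loops and parallel edges are allowed), with edge weights $\mathrm{wt}(e)$ in a commutative Hausdorff topological ring $R$ (for example an arbitrary commutative ring with the discrete topology, $\mathbb{R}$, or a ring of formal power series), and let $B$ be a set of vertices with a total order. The weight of a walk is the product of the weights of its edges, and the weight of a family of walks is the product of the weights of its members. The loop-erasure $\mathrm{LE}(w)$ of a walk $w$ is the path obtained by following $w$ and erasing each loop as it forms. For $k$-tuples $\mathbf a=(a_1,\dots,a_k)$ and $\mathbf b=(b_1,\dots,b_k)$ of vertices let $\mathrm{Walk}_k(\mathbf a,\mathbf b)$ be the set of families $(w_1,\dots,w_k)$ of walks $w_i\colon a_i\to b_i$ such that $w_j$ is vertex-disjoint from $\mathrm{LE}(w_i)$ whenever $i<j$, and put \[\tilde W_k(\mathbf a,\mathbf b)=\sum_{\sigma\in S_k}\mathrm{sgn}(\sigma)\sum_{\mathbf w\in \mathrm{Walk}_k(\mathbf a,\mathbf b_\sigma)}\mathrm{wt}(\mathbf w),\qquad \mathbf b_\sigma=(b_{\sigma(1)},\dots,b_{\sigma(k)}),\] \[\tilde Q_k(\mathbf a)=\sum_{\substack{\mathbf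 b\in B^k\\ b_1<\dots<b_k}}\tilde W_k(\mathbf a,\mathbf b).\] Let $k$ be even and let $\mathbf a=(a_1,\dots,a_k)$ be a tuple of vertices of $G$. Assume that the sums involved converge unconditionally: the sums in the definitions of $\tilde Q_k(\mathbf a)$ and of $\tilde Q_2(a_i,a_j)$ for all $i,j$ (where the inner sums over $\mathrm{Walk}_k(\mathbf a,\mathbf b)$, $\mathrm{Walk}_2((a_i,a_j),\mathbf b)$ are taken for all tuples $\mathbf b$ in $B$), and, for all distinct indices $i_1,\dots,i_m$ and all $b_1,\dots,b_m\in B$, the sum of the weights of all families of walks $w_r\colon a_{i_r}\to b_r$, $1\le r\le m$. Then the matrix $\bigl(\tilde Q_2(a_i,a_j)\bigr)_{i,j=1}^k$ is skew-symmetric with zero diagonal, and \[\tilde Q_k(\mathbf a)=\mathrm{Pf}\bigl(\tilde Q_2(a_i,a_j)\bigr)_{i,j=1}^k .\] Here $\mathrm{Pf}(M)$ is the sum, over the perfect matchings of $\{1,\dots,k\}$, of the product of the entries $M_{ij}$ with $i<j$ matched, with sign $(-1)^c$, where $c$ is the number of crossings of the matching. If moreover $G$ is acyclic, then the same identity holds,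 without any compatibility assumption on $\mathbf a$ and $B$, when $\mathrm{Walk}_k(\mathbf a,\mathbf b)$ is replaced by the set of families of pairwise vertex-disjoint paths $p_i\colon a_i\to b_i$ in the definitions of $\tilde W_k$ and $\tilde Q_k$ (and likewise for $k=2$). -/

import Mathlib

/-!
A directed graph is a `Quiver` (loops and parallel edges are allowed), a walk from `a` to `b` is a
`Quiver.Path a b`, `Quiver.Path.vertices` is the list of all vertices a walk visits (both ends
included), and `Quiver.Path.weight wt` is the product of the weights of its edges.
-/

namespace LoopErasedWalks

open Quiver

section Walks

variable {V : Type*} [Quiver V]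

open scoped Classical in
/-- The initial segment of a walk `p`, up to the first visit to the vertex `c`. -/
noncomputable def initialSegment {a : V} :
    ∀ {b : V} (p : Path a b) (c : V), c ∈ p.vertices → Path a c
  | _, Path.nil, _, h => (List.mem_singleton.mp h) ▸ Path.nil
  | _, Path.cons p e, c, h =>
      if h' : c ∈ p.vertices then initialSegment p c h'
      else (((Path.mem_vertices_cons p e).mp h).resolve_left h') ▸ p.cons e

open scoped Classical in
/-- The loop-erasure of a walk: follow the walk and, whenever a step leads back to a vertex `c` of
the path kept so far, delete the loop at `c` that this step closes. -/
noncomputable def loopErasure {a : V} : ∀ {b : V}, Path a b → Path a b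
  | _, Path.nil => Path.nil
  | c, Path.cons p e =>
      if h : c ∈ (loopErasure p).vertices then initialSegment (loopErasure p) c h
      else (loopErasure p).cons e

/-- Two walks are vertex-disjoint. -/
def VertexDisjoint {a b c d : V} (p : Path a b) (q : Path c d) : Prop :=
  ∀ v, v ∈ p.vertices → v ∉ q.vertices

/-- All families `(w₁, …, w_k)` of walks `w_i : a_i → b_i`, without any disjointness condition. -/
abbrev AllFamilies {k : ℕ} (a b : Fin k → V) : Type _ :=
  ∀ i, Path (a i) (b i)

/-- `Walk_k(a, b)`: the families of walks `w_i : a_i → b_i` such that `w_j` is vertex-disjoint from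
the loop-erasure of `w_i` whenever `i < j`. -/
abbrev WalkFamilies {k : ℕ} (a b : Fin k → V) : Type _ :=
  {w : AllFamilies a b // ∀ i j, i < j → VertexDisjoint (w j) (loopErasure (w i))}

/-- `Path_k(a, b)`: the families of pairwise vertex-disjoint paths `p_i : a_i → b_i`, where a path
is a walk without repeated vertices. -/
abbrev PathFamilies {k : ℕ} (a b : Fin k → V) : Type _ :=
  {p : AllFamilies a b // (∀ i, (p i).vertices.Nodup) ∧ ∀ i j, i ≠ j → VertexDisjoint (p i) (p j)}

variable (V) in
/-- The graph has no directed cycle: the only closed walks are the trivial ones. -/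
def IsAcyclic : Prop :=
  ∀ (v : V) (p : Path v v), p = Path.nil

end Walks

section Sums

variable {V : Type*} [Quiver V] {R : Type*} [CommRing R]

/-- The weight of a family of walks is the product of the weights of its members. -/
def familyWeight (wt : ∀ {u v : V}, (u ⟶ v) → R) {k : ℕ} {a b : Fin k → V}
    (w : AllFamilies a b) : R :=
  ∏ i, (w i).weight wt

variable [TopologicalSpace R]

/-- The signed sum `W̃_k(a, b)` of the weights of the families in `Walk_k(a, b_σ)`. -/
noncomputable def signedWalkSum (wt : ∀ {u v : V}, (u ⟶ v) → R) {k : ℕ} (a b : Fin k → V) : R :=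
  ∑ σ : Equiv.Perm (Fin k),
    ((Equiv.Perm.sign σ : ℤ) : R) * ∑' w : WalkFamilies a (b ∘ σ), familyWeight wt w.1

/-- The signed sum `P̃_k(a, b)` of the weights of the families in `Path_k(a, b_σ)`. -/
noncomputable def signedPathSum (wt : ∀ {u v : V}, (u ⟶ v) → R) {k : ℕ} (a b : Fin k → V) : R :=
  ∑ σ : Equiv.Perm (Fin k),
    ((Equiv.Perm.sign σ : ℤ) : R) * ∑' p : PathFamilies a (b ∘ σ), familyWeight wt p.1

/-- The tuples `b₁ < ⋯ < b_k` in an ordered vertex subset `B`. -/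
abbrev IncreasingTuples (B : Set V) [LinearOrder B] (k : ℕ) : Type _ :=
  {b : Fin k → B // StrictMono b}

/-- `Q̃_k(a)`: the sum of `W̃_k(a, b)` over the increasing tuples `b` in `B`. -/
noncomputable def walkQ (wt : ∀ {u v : V}, (u ⟶ v) → R) (B : Set V) [LinearOrder B]
    {k : ℕ} (a : Fin k → V) : R :=
  ∑' b : IncreasingTuples B k, signedWalkSum wt a (fun i => (b.1 i : V))

/-- The analogue of `walkQ` for families of disjoint paths: the sum of `P̃_k(a, b)` over the
increasing tuples `b` in `B`. -/
noncomputable def pathQ (wt : ∀ {u v : V}, (u ⟶ v) → R) (B : Set V) [LinearOrder B]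
    {k : ℕ} (a : Fin k → V) : R :=
  ∑' b : IncreasingTuples B k, signedPathSum wt a (fun i => (b.1 i : V))

/-- The sums over families of walks that the determinants `det W(a_i, b_j)` expand into converge:
for every choice of distinct entries of `a` and every choice of targets in `B`, the weights of all
families of walks from those entries to those targets are summable. For a single entry this is the
convergence of `W(a_i, b)`. -/
def WalkSumsConverge (wt : ∀ {u v : V}, (u ⟶ v) → R) (B : Set V) {k : ℕ} (a : Fin k → V) : Prop :=
  ∀ (m : ℕ) (ι : Fin m ↪ Fin k) (b : Fin m → B),
    Summable fun w : AllFamilies (a ∘ ι) (fun i => (b i : V)) => familyWeight wt w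

/-- The sums in the definition of `Q̃_k(a)` converge: the sums over `Walk_k(a, b)` for `b ∈ B^k`, and
the sum over increasing tuples `b`. The latter is a finite sum if `B` is finite. -/
structure QSumsConverge (wt : ∀ {u v : V}, (u ⟶ v) → R) (B : Set V) [LinearOrder B]
    {k : ℕ} (a : Fin k → V) : Prop where
  families : ∀ b : Fin k → B,
    Summable fun w : WalkFamilies a (fun i => (b i : V)) => familyWeight wt w.1
  tuples :
    Summable fun b : IncreasingTuples B k => signedWalkSum wt a (fun i => (b.1 i : V))

end Sums

section Pfaffian

/-- A perfect matching of `{1, …, n}`, as the involution without fixed points that sends each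
element to its partner. -/
abbrev PerfectMatching (n : ℕ) : Type :=
  {f : Equiv.Perm (Fin n) // ∀ i, f (f i) = i ∧ f i ≠ i}

/-- The number of crossings of a perfect matching: pairs of arcs `i — f i`, `j — f j` with
`i < j < f i < f j`. -/
def crossings {n : ℕ} (f : PerfectMatching n) : ℕ :=
  (Finset.univ.filter fun p : Fin n × Fin n =>
    p.1 < p.2 ∧ p.2 < f.1 p.1 ∧ f.1 p.1 < f.1 p.2).card

/-- The Pfaffian of a skew-symmetric matrix, as a polynomial in its above-diagonal entries: the sum
over the perfect matchings of the rows of the products of the entries `M i j` with `i < j` matched,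
with a sign given by the parity of the number of crossings. -/
def pfaffian {n : ℕ} {R : Type*} [CommRing R] (M : Matrix (Fin n) (Fin n) R) : R :=
  ∑ f : PerfectMatching n,
    (-1) ^ crossings f * ∏ i with i < f.1 i, M i (f.1 i)

end Pfaffian

end LoopErasedWalks

/-!
If a family of walks violates the condition defining `Walk_k`, take the first walk `i` whose
loop-erasure is met by a later walk, the first vertex `v` of it on a later walk, and the first
later walk `j` through `v`. Exchanging the parts of `w_i` and `w_j` after their last visits
to `v` preserves the weight and the crossing `(i, j, v)`, and transposes two targets, so it is a
sign-reversing involution. This is why the last visits are used: the initial part of `LE(w_i)` up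
to `v` survives exactly when the part of `w_i` after the last visit to `v` avoids it. Hence
`W̃_k(a, b)` is the determinant of the total weights `W(a_i, b_j)`, and `Q̃_k(a)` is a sum of
maximal minors, a limit of such sums over finite subsets of `B`.

Over a finite index set, let `S` be the skew-symmetric matrix with all entries above the diagonal
equal to `1`. Expanding the product of the entries of `M S Mᵀ` along each matching gives
`Pf(M S Mᵀ) = ∑ b, (∏ i, M i (b i)) Pf(S_b)`, and `Pf(S_b)` is the sign of the permutation
sorting `b` if `b` is injective, and zero otherwise. So `Pf(M S Mᵀ)` is the sum of the
maximal minors of `M`; for two rows of `M` this says that the entries of `M S Mᵀ` are sums of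
`2 × 2` minors. In an acyclic graph every walk is its own loop-erasure.
-/

namespace LoopErasedWalks

section Matchings

variable {n : ℕ}

theorem PerfectMatching.apply_apply (f : PerfectMatching n) (i : Fin n) : f.1 (f.1 i) = i :=
  (f.2 i).1

theorem PerfectMatching.apply_ne (f : PerfectMatching n) (i : Fin n) : f.1 i ≠ i :=
  (f.2 i).2

theorem PerfectMatching.apply_eq_iff (f : PerfectMatching n) {i j : Fin n} :
    f.1 i = j ↔ i = f.1 j :=
  ⟨fun h => by rw [← h, f.apply_apply], fun h => by rw [h, f.apply_apply]⟩

/-- The matching obtained from `f` by relabelling the points along `τ`: it joins `τ i` and `τ j`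
whenever `f` joins `i` and `j`. -/
def PerfectMatching.relabel (τ : Equiv.Perm (Fin n)) (f : PerfectMatching n) : PerfectMatching n :=
  ⟨τ * f.1 * τ⁻¹, fun i => by
    simp [f.apply_apply, ← Equiv.Perm.eq_inv_iff_eq (f := τ), f.apply_ne]⟩

theorem PerfectMatching.relabel_apply (τ : Equiv.Perm (Fin n)) (f : PerfectMatching n) (i : Fin n) :
    (f.relabel τ).1 (τ i) = τ (f.1 i) := by
  simp [relabel]

theorem PerfectMatching.relabel_swap_involutive (x y : Fin n) :
    Function.Involutive (PerfectMatching.relabel (Equiv.swap x y)) := fun f => by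
  ext i
  simp [relabel]

theorem PerfectMatching.relabel_swap_eq_self {x y : Fin n} {f : PerfectMatching n}
    (hf : f.1 x = y) : f.relabel (Equiv.swap x y) = f := by
  have hfy : f.1 y = x := by rw [← hf, f.apply_apply]
  ext i : 2
  obtain ⟨j, rfl⟩ := (Equiv.swap x y).surjective i
  rw [f.relabel_apply]
  grind [f.apply_apply j]

theorem PerfectMatching.relabel_swap_apply_left {x y : Fin n} {f : PerfectMatching n}
    (hf : f.1 x ≠ y) : (f.relabel (Equiv.swap x y)).1 x ≠ y := by
  have hfy : f.1 y ≠ x := fun h => hf (f.apply_eq_iff.mp h).symm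
  have h := f.relabel_apply (Equiv.swap x y) y
  rw [Equiv.swap_apply_right, Equiv.swap_apply_of_ne_of_ne hfy (f.apply_ne y)] at h
  exact h ▸ f.apply_ne y

theorem swap_lt_swap_iff_of_covBy {α : Type*} [LinearOrder α] {x y : α} (hxy : x ⋖ y) (u v : α) :
    Equiv.swap x y u < Equiv.swap x y v ↔ (u < v ∧ ¬(u = x ∧ v = y)) ∨ (u = y ∧ v = x) := by
  have hlt := hxy.lt
  have hu : u ≤ x ∨ y ≤ u := (le_or_gt u x).imp_right hxy.ge_of_gt
  have hv : v ≤ x ∨ y ≤ v := (le_or_gt v x).imp_right hxy.ge_of_gt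
  grind

/-- The arcs of `f` starting at `p.1` and at `p.2` cross, the former starting first. -/
abbrev PerfectMatching.IsCrossing (f : PerfectMatching n) (p : Fin n × Fin n) : Prop :=
  p.1 < p.2 ∧ p.2 < f.1 p.1 ∧ f.1 p.1 < f.1 p.2

/-- The exceptional pair `q` consists of the left ends of the arcs at `x` and `y`. -/
theorem PerfectMatching.exists_isCrossing_relabel_swap_iff {x y : Fin n} (hxy : x ⋖ y)
    {f : PerfectMatching n} (hf : f.1 x ≠ y) :
    ∃ q, ∀ p : Fin n × Fin n,
      (f.relabel (Equiv.swap x y)).IsCrossing (p.map (Equiv.swap x y) (Equiv.swap x y)) ↔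
        (f.IsCrossing p ↔ p ≠ q) := by
  simp only [IsCrossing, Prod.map_fst, Prod.map_snd, relabel_apply, swap_lt_swap_iff_of_covBy hxy,
    f.apply_eq_iff (j := x), f.apply_eq_iff (j := y)]
  have hff := f.apply_apply
  have hlt := hxy.lt
  have hx := f.apply_ne x
  have hy := f.apply_ne y
  have hne : f.1 x ≠ f.1 y := f.1.injective.ne hlt.ne
  have hx' := hff x
  have hy' := hff y
  have hfy : f.1 y ≠ x := fun h => hf (f.apply_eq_iff.mp h).symm
  obtain ⟨q, hq⟩ : ∃ q : Fin n × Fin n,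
      (q = (x, y) ∧ x < f.1 x ∧ y < f.1 y ∧ f.1 x < f.1 y) ∨
      (q = (y, x) ∧ x < f.1 x ∧ y < f.1 y ∧ f.1 y < f.1 x) ∨
      (q = (f.1 x, f.1 y) ∧ f.1 x < x ∧ f.1 y < y ∧ f.1 x < f.1 y) ∨
      (q = (f.1 y, f.1 x) ∧ f.1 x < x ∧ f.1 y < y ∧ f.1 y < f.1 x) ∨
      (q = (f.1 x, y) ∧ f.1 x < x ∧ y < f.1 y) ∨
      (q = (f.1 y, x) ∧ x < f.1 x ∧ f.1 y < y) := by
    rcases lt_or_gt_of_ne hx with h₁ | h₁ <;> rcases lt_or_gt_of_ne hy with h₂ | h₂ <;>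
      rcases lt_or_gt_of_ne hne with h₃ | h₃ <;> simp [h₁, h₂, h₃, not_lt_of_gt]
  have hfx_cov : f.1 x ≤ x ∨ y ≤ f.1 x := (le_or_gt _ x).imp_right hxy.ge_of_gt
  have hfy_cov : f.1 y ≤ x ∨ y ≤ f.1 y := (le_or_gt _ x).imp_right hxy.ge_of_gt
  refine ⟨q, fun ⟨i, j⟩ => ?_⟩
  rcases hq with h | h | h | h | h | h <;> obtain ⟨rfl, h⟩ := h <;> grind

section Pfaffian

open scoped Matrix

variable {R : Type*} [CommRing R]

theorem prod_eq_neg_prod {ι : Type*} [Fintype ι] {g h : ι → R} (q : ι) (hq : g q = -h q)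
    (hgh : ∀ p ≠ q, g p = h p) : ∏ p, g p = -∏ p, h p := by
  classical
  rw [← Finset.mul_prod_erase _ g (Finset.mem_univ q),
    ← Finset.mul_prod_erase _ h (Finset.mem_univ q), hq,
    Finset.prod_congr rfl fun p hp => hgh p (Finset.ne_of_mem_erase hp), neg_mul]

theorem neg_one_pow_crossings (f : PerfectMatching n) :
    (-1 : R) ^ crossings f = ∏ p, if f.IsCrossing p then -1 else 1 := by
  rw [Finset.prod_ite, Finset.prod_const, Finset.prod_const_one, mul_one, crossings]

theorem neg_one_pow_crossings_relabel_swap {x y : Fin n} (hxy : x ⋖ y) {f : PerfectMatching n}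
    (hf : f.1 x ≠ y) :
    (-1 : R) ^ crossings (f.relabel (Equiv.swap x y)) = -(-1 : R) ^ crossings f := by
  obtain ⟨q, hq⟩ := f.exists_isCrossing_relabel_swap_iff hxy hf
  rw [neg_one_pow_crossings, neg_one_pow_crossings,
    ← Equiv.prod_comp ((Equiv.swap x y).prodCongr (Equiv.swap x y))]
  refine prod_eq_neg_prod q ?_ fun p hp => ?_
  · rw [Equiv.prodCongr_apply, if_congr (hq q) rfl rfl]
    split_ifs <;> simp_all
  · rw [Equiv.prodCongr_apply, if_congr (hq p) rfl rfl]
    simp only [hp, ne_eq, not_false_eq_true, iff_true]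

theorem prod_arcs_submatrix_swap {x y : Fin n} (hxy : x ⋖ y) {A : Matrix (Fin n) (Fin n) R}
    (hA : Aᵀ = -A) {f : PerfectMatching n} (hf : f.1 x = y) :
    ∏ i with i < f.1 i, A.submatrix (Equiv.swap x y) (Equiv.swap x y) i (f.1 i) =
      -∏ i with i < f.1 i, A i (f.1 i) := by
  have hfy : f.1 y = x := by rw [← hf, f.apply_apply]
  rw [Finset.prod_filter, Finset.prod_filter]
  refine prod_eq_neg_prod x ?_ fun i hix => ?_
  · simpa [hf, hxy.lt] using congr_fun₂ hA x y
  · rcases eq_or_ne i y with rfl | hiy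
    · simp [hfy, hxy.lt.not_gt]
    · have hfix : f.1 i ≠ x := fun h => hiy (by rw [← hf, ← h, f.apply_apply])
      have hfiy : f.1 i ≠ y := fun h => hix (by rw [← hfy, ← h, f.apply_apply])
      rw [Matrix.submatrix_apply, Equiv.swap_apply_of_ne_of_ne hix hiy,
        Equiv.swap_apply_of_ne_of_ne hfix hfiy]

theorem prod_arcs_relabel_swap {x y : Fin n} (hxy : x ⋖ y) (A : Matrix (Fin n) (Fin n) R)
    {f : PerfectMatching n} (hf : f.1 x ≠ y) :
    ∏ i with i < (f.relabel (Equiv.swap x y)).1 i, A i ((f.relabel (Equiv.swap x y)).1 i) =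
      ∏ i with i < f.1 i, A.submatrix (Equiv.swap x y) (Equiv.swap x y) i (f.1 i) := by
  have hfy : f.1 y ≠ x := fun h => hf (f.apply_eq_iff.mp h).symm
  rw [Finset.prod_filter, Finset.prod_filter, ← Equiv.prod_comp (Equiv.swap x y)]
  simp only [f.relabel_apply, swap_lt_swap_iff_of_covBy hxy, Matrix.submatrix_apply]
  exact Finset.prod_congr rfl fun i _ => if_congr (by grind) rfl rfl

theorem pfaffian_submatrix_swap {x y : Fin n} (hxy : x ⋖ y) {A : Matrix (Fin n) (Fin n) R}
    (hA : Aᵀ = -A) :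
    pfaffian (A.submatrix (Equiv.swap x y) (Equiv.swap x y)) = -pfaffian A := by
  unfold pfaffian
  rw [← Equiv.sum_comp (PerfectMatching.relabel_swap_involutive x y).toPerm
      fun f => (-1) ^ crossings f * ∏ i with i < f.1 i, A i (f.1 i), ← Finset.sum_neg_distrib]
  refine Finset.sum_congr rfl fun f _ => ?_
  rw [Function.Involutive.coe_toPerm]
  by_cases hf : f.1 x = y
  · rw [PerfectMatching.relabel_swap_eq_self hf, prod_arcs_submatrix_swap hxy hA hf, mul_neg]
  · rw [neg_one_pow_crossings_relabel_swap hxy hf, prod_arcs_relabel_swap hxy A hf, neg_mul,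
      neg_neg]

theorem pfaffian_submatrix_perm (π : Equiv.Perm (Fin n)) {A : Matrix (Fin n) (Fin n) R}
    (hA : Aᵀ = -A) : pfaffian (A.submatrix π π) = ((Equiv.Perm.sign π : ℤ) : R) * pfaffian A := by
  cases n with
  | zero => simp [Subsingleton.elim π 1]
  | succ m =>
    have hπ : π ∈ Submonoid.closure (Set.range fun i : Fin m => Equiv.swap i.castSucc i.succ) := by
      rw [Equiv.Perm.mclosure_swap_castSucc_succ]; trivial
    induction hπ using Submonoid.closure_induction generalizing A with
    | one => simp
    | mem π hπ =>
      obtain ⟨i, rfl⟩ := hπ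
      have hcov : i.castSucc ⋖ i.succ := by simp
      rw [pfaffian_submatrix_swap hcov hA,
        Equiv.Perm.sign_swap i.castSucc_lt_succ.ne]
      simp
    | mul π ρ _ _ hπ hρ =>
      have hAπ : (A.submatrix π π)ᵀ = -A.submatrix π π := by
        rw [Matrix.transpose_submatrix, hA, Matrix.submatrix_neg]; rfl
      rw [Equiv.Perm.coe_mul, ← Matrix.submatrix_submatrix, hρ hAπ, hπ hA, Equiv.Perm.sign_mul]
      push_cast
      ring

theorem pfaffian_map {S : Type*} [CommRing S] (φ : R →+* S) (A : Matrix (Fin n) (Fin n) R) :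
    pfaffian (A.map φ) = φ (pfaffian A) := by
  simp [pfaffian, map_sum, map_prod]

theorem sum_neg_one_pow_crossings_filter {x y : Fin n} (hxy : x ⋖ y)
    {P : PerfectMatching n → Prop} [DecidablePred P]
    (hP : ∀ f, P f → P (f.relabel (Equiv.swap x y))) :
    ∑ f with P f, (-1 : R) ^ crossings f = ∑ f with P f ∧ f.1 x = y, (-1) ^ crossings f := by
  rw [← Finset.sum_filter_add_sum_filter_not _ (fun f : PerfectMatching n => f.1 x = y),
    Finset.filter_filter, Finset.filter_filter, add_eq_left]
  refine Finset.sum_involution (fun f _ => f.relabel (Equiv.swap x y)) ?_ ?_ ?_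
    fun f _ => PerfectMatching.relabel_swap_involutive x y f
  · intro f hf
    rw [neg_one_pow_crossings_relabel_swap hxy (Finset.mem_filter.mp hf).2.2, add_neg_cancel]
  · intro f hf _ h
    have hfx : f.1 x ≠ y := (Finset.mem_filter.mp hf).2.2
    have hx := f.relabel_apply (Equiv.swap x y) x
    rw [h, Equiv.swap_apply_left, Equiv.swap_apply_of_ne_of_ne (f.apply_ne x) hfx] at hx
    exact hxy.ne' (f.1.injective hx)
  · intro f hf
    simp only [Finset.mem_filter, Finset.mem_univ, true_and] at hf ⊢
    exact ⟨hP f hf.1, PerfectMatching.relabel_swap_apply_left hf.2⟩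

theorem sum_neg_one_pow_crossings_filter_pairs {J : Type*} {e : J × Fin 2 ≃ Fin n}
    (he : ∀ j, e (j, 0) ⋖ e (j, 1)) (L : Finset J) :
    ∑ f : PerfectMatching n, (-1 : R) ^ crossings f =
      ∑ f : PerfectMatching n with ∀ j ∈ L, f.1 (e (j, 0)) = e (j, 1), (-1) ^ crossings f := by
  classical
  induction L using Finset.induction with
  | empty => simp
  | insert k L hk ih =>
    rw [ih, sum_neg_one_pow_crossings_filter (he k)]
    · simp only [Finset.forall_mem_insert, and_comm]
    · intro f hf j hj
      have hjk : j ≠ k := ne_of_mem_of_not_mem hj hk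
      have hfix (b : Fin 2) : Equiv.swap (e (k, 0)) (e (k, 1)) (e (j, b)) = e (j, b) :=
        Equiv.swap_apply_of_ne_of_ne (by simp [hjk]) (by simp [hjk])
      rw [← hfix 0, f.relabel_apply, hf j hj, hfix]

/-- The matching with the arcs `e (j, 0) — e (j, 1)`. -/
def PerfectMatching.ofPairs {J : Type*} (e : J × Fin 2 ≃ Fin n) : PerfectMatching n :=
  ⟨e.permCongr ((Equiv.refl J).prodCongr (Equiv.swap 0 1)), fun i => by
    obtain ⟨⟨j, b⟩, rfl⟩ := e.surjective i
    fin_cases b <;> simp⟩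

theorem PerfectMatching.eq_ofPairs_iff {J : Type*} {e : J × Fin 2 ≃ Fin n}
    {f : PerfectMatching n} : f = ofPairs e ↔ ∀ j, f.1 (e (j, 0)) = e (j, 1) := by
  refine ⟨fun h j => by simp [h, ofPairs], fun h => ?_⟩
  ext i : 2
  obtain ⟨⟨j, b⟩, rfl⟩ := e.surjective i
  fin_cases b
  · simp [ofPairs, h]
  · simp [ofPairs, f.apply_eq_iff, h]

theorem crossings_ofPairs {J : Type*} {e : J × Fin 2 ≃ Fin n} (he : ∀ j, e (j, 0) ⋖ e (j, 1)) :
    crossings (PerfectMatching.ofPairs e) = 0 := by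
  rw [crossings, Finset.card_eq_zero, Finset.filter_eq_empty_iff]
  rintro ⟨i, k⟩ _ ⟨hik, hki, _⟩
  obtain ⟨⟨j, b⟩, rfl⟩ := e.surjective i
  fin_cases b
  · refine (he j).2 hik ?_
    simpa [PerfectMatching.ofPairs] using hki
  · refine ((he j).lt.trans (hik.trans ?_)).false
    simpa [PerfectMatching.ofPairs] using hki

theorem sum_neg_one_pow_crossings (hn : Even n) :
    ∑ f : PerfectMatching n, (-1 : R) ^ crossings f = 1 := by
  obtain ⟨m, rfl⟩ := hn.two_dvd
  rw [mul_comm 2 m]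
  have he (j : Fin m) : finProdFinEquiv (j, (0 : Fin 2)) ⋖ finProdFinEquiv (j, 1) := by
    simp [Nat.covBy_iff_add_one_eq, add_comm]
  rw [sum_neg_one_pow_crossings_filter_pairs he Finset.univ]
  simp only [Finset.mem_univ, true_imp_iff, ← PerfectMatching.eq_ofPairs_iff, Finset.filter_eq',
    if_true, Finset.sum_singleton, crossings_ofPairs he, pow_zero]

theorem pfaffian_fin_two (A : Matrix (Fin 2) (Fin 2) R) : pfaffian A = A 0 1 := by
  have hswap (f : PerfectMatching 2) : f.1 = Equiv.swap 0 1 := by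
    have h₀ : f.1 0 = 1 := by grind [f.apply_ne 0]
    have h₁ : f.1 1 = 0 := by grind [f.apply_ne 1]
    ext i
    fin_cases i <;> simp [h₀, h₁]
  let f₀ : PerfectMatching 2 := ⟨Equiv.swap 0 1, by decide⟩
  have hcross : crossings f₀ = 0 := by decide
  have harcs : Finset.univ.filter (fun i => i < f₀.1 i) = {0} := by decide
  rw [pfaffian, Fintype.sum_eq_single f₀ fun f hf => absurd (Subtype.ext (hswap f)) hf, hcross,
    harcs, pow_zero, one_mul, Finset.prod_singleton]
  simp [f₀]

section SignMatrix

variable {β : Type*} [LinearOrder β]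

variable (R β) in
/-- The skew-symmetric matrix with all entries above the diagonal equal to `1`. -/
def signMatrix : Matrix β β R :=
  Matrix.of fun x y => if x < y then 1 else if y < x then -1 else 0

theorem signMatrix_transpose : (signMatrix R β)ᵀ = -signMatrix R β := by
  ext x y
  rcases lt_trichotomy x y with h | rfl | h <;> simp [signMatrix, *, not_lt_of_gt]

theorem signMatrix_map_intCast : (signMatrix ℤ β).map (Int.castRingHom R) = signMatrix R β := by
  ext x y
  simp only [signMatrix, Matrix.map_apply, Matrix.of_apply, apply_ite (Int.castRingHom R),
    map_one, map_neg, map_zero]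

theorem signMatrix_submatrix {α : Type*} [LinearOrder α] {c : α → β} (hc : StrictMono c) :
    (signMatrix R β).submatrix c c = signMatrix R α := by
  ext x y
  simp [signMatrix, hc.lt_iff_lt]

theorem pfaffian_signMatrix (hn : Even n) : pfaffian (signMatrix R (Fin n)) = 1 := by
  rw [← sum_neg_one_pow_crossings (R := R) hn]
  refine Finset.sum_congr rfl fun f _ => ?_
  rw [Finset.prod_eq_one, mul_one]
  intro i hi
  simp [signMatrix, (Finset.mem_filter.mp hi).2]

theorem pfaffian_signMatrix_submatrix_of_strictMono (hn : Even n) {c : Fin n → β}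
    (hc : StrictMono c) (σ : Equiv.Perm (Fin n)) :
    pfaffian ((signMatrix R β).submatrix (c ∘ σ) (c ∘ σ)) = ((Equiv.Perm.sign σ : ℤ) : R) := by
  rw [← Matrix.submatrix_submatrix, signMatrix_submatrix hc,
    pfaffian_submatrix_perm σ signMatrix_transpose, pfaffian_signMatrix hn, mul_one]

theorem pfaffian_signMatrix_submatrix_of_not_injective {b : Fin n → β}
    (hb : ¬Function.Injective b) : pfaffian ((signMatrix R β).submatrix b b) = 0 := by
  obtain ⟨x, y, hbxy, hxy⟩ : ∃ x y, b x = b y ∧ x ≠ y := by simpa [Function.Injective] using hb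
  have hbs : b ∘ Equiv.swap x y = b := by
    ext i
    rw [Function.comp_apply, Equiv.swap_apply_def]
    split_ifs <;> simp_all
  -- Over `ℤ`, a Pfaffian that equals its own negative vanishes.
  have hint : pfaffian ((signMatrix ℤ β).submatrix b b) = 0 := by
    have hskew : ((signMatrix ℤ β).submatrix b b)ᵀ = -(signMatrix ℤ β).submatrix b b := by
      rw [Matrix.transpose_submatrix, signMatrix_transpose, Matrix.submatrix_neg]; rfl
    have hneg := pfaffian_submatrix_perm (Equiv.swap x y) hskew
    rw [Matrix.submatrix_submatrix, hbs, Equiv.Perm.sign_swap hxy] at hneg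
    simpa [self_eq_neg] using hneg
  rw [← signMatrix_map_intCast, Matrix.submatrix_map, pfaffian_map, hint, map_zero]

end SignMatrix

theorem prod_arcs_mul (f : PerfectMatching n) (g : Fin n → R) :
    ∏ i with i < f.1 i, g i * g (f.1 i) = ∏ i, g i := by
  rw [← Finset.prod_filter_mul_prod_filter_not Finset.univ (fun i => i < f.1 i),
    Finset.prod_mul_distrib]
  congr 1
  refine Finset.prod_nbij' f.1 f.1 ?_ ?_ (fun i _ => f.apply_apply i) (fun i _ => f.apply_apply i)
    fun i _ => rfl
  · simp +contextual [f.apply_apply, le_of_lt]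
  · simp +contextual [f.apply_apply, (f.apply_ne _).lt_of_le]

/-- Labelling all points by `β` amounts to labelling the arcs of a matching by pairs, the first
entry for the left end and the second for the right end. -/
def PerfectMatching.arcLabelEquiv (β : Type*) (f : PerfectMatching n) :
    (Fin n → β) ≃ ({i // i < f.1 i} → β × β) where
  toFun b i := (b i, b (f.1 i))
  invFun p j :=
    if h : j < f.1 j then (p ⟨j, h⟩).1
    else (p ⟨f.1 j, by simpa [f.apply_apply] using (f.apply_ne j).lt_of_le (not_lt.mp h)⟩).2
  left_inv b := by
    ext j
    simp [f.apply_apply]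
  right_inv p := by
    ext1 ⟨i, hi⟩
    simp [hi, hi.not_gt, f.apply_apply]

theorem prod_arcs_mul_mul_transpose {β : Type*} [Fintype β] (M : Matrix (Fin n) β R)
    (S : Matrix β β R) (f : PerfectMatching n) :
    ∏ i with i < f.1 i, (M * S * Mᵀ) i (f.1 i) =
      ∑ b : Fin n → β, (∏ i, M i (b i)) * ∏ i with i < f.1 i, S.submatrix b b i (f.1 i) := by
  have hentry (i j : Fin n) :
      (M * S * Mᵀ) i j = ∑ p : β × β, M i p.1 * M j p.2 * S p.1 p.2 := by
    simp only [Matrix.mul_apply, Matrix.transpose_apply, Finset.sum_mul,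
      Fintype.sum_prod_type_right, mul_right_comm]
  simp only [hentry]
  rw [← Finset.prod_subtype_eq_prod_filter, Finset.subtype_univ, Finset.prod_univ_sum,
    Fintype.piFinset_univ, ← Equiv.sum_comp (f.arcLabelEquiv β)]
  refine Finset.sum_congr rfl fun b _ => ?_
  rw [← prod_arcs_mul f fun i => M i (b i), ← Finset.prod_mul_distrib,
    ← Finset.prod_subtype_eq_prod_filter, Finset.subtype_univ]
  rfl

theorem pfaffian_mul_mul_transpose {β : Type*} [Fintype β] (M : Matrix (Fin n) β R)
    (S : Matrix β β R) :
    pfaffian (M * S * Mᵀ) = ∑ b : Fin n → β, (∏ i, M i (b i)) * pfaffian (S.submatrix b b) := by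
  simp only [pfaffian, prod_arcs_mul_mul_transpose, Finset.mul_sum]
  rw [Finset.sum_comm]
  exact Finset.sum_congr rfl fun b _ => Finset.sum_congr rfl fun f _ => mul_left_comm ..

section MinorSum

variable {β : Type*} [Fintype β] [LinearOrder β]

theorem sum_strictMono_perm (F : (Fin n → β) → R) (hF : ∀ b, ¬Function.Injective b → F b = 0) :
    ∑ c : {c : Fin n → β // StrictMono c}, ∑ σ : Equiv.Perm (Fin n), F (c.1 ∘ σ) = ∑ b, F b := by
  rw [← Fintype.sum_prod_type']
  refine Fintype.sum_of_injective
    (fun q : {c : Fin n → β // StrictMono c} × Equiv.Perm (Fin n) => q.1.1 ∘ q.2) ?_ _ _ ?_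
    fun _ => rfl
  · rintro ⟨⟨c, hc⟩, σ⟩ ⟨⟨d, hd⟩, τ⟩ h
    obtain rfl : c = d :=
      (hc.range_inj hd).mp (by simpa [Set.range_comp] using congrArg Set.range h)
    have hστ : σ = τ := Equiv.ext fun i => hc.injective (congrFun h i)
    rw [hστ]
  · refine fun b hb => hF b fun hinj => hb ⟨⟨⟨b ∘ Tuple.sort b,
      (Tuple.monotone_sort b).strictMono_of_injective (hinj.comp (Equiv.injective _))⟩,
      (Tuple.sort b)⁻¹⟩, ?_⟩
    ext i
    simp

/-- The sum of the maximal minors of a matrix whose columns are ordered. -/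
def maxMinorSum (M : Matrix (Fin n) β R) : R :=
  ∑ c : {c : Fin n → β // StrictMono c}, (M.submatrix id c.1).det

theorem maxMinorSum_eq_pfaffian_mul (hn : Even n) (M : Matrix (Fin n) β R) :
    maxMinorSum M = pfaffian (M * signMatrix R β * Mᵀ) := by
  rw [pfaffian_mul_mul_transpose, ← sum_strictMono_perm]
  · refine Finset.sum_congr rfl fun c _ => ?_
    rw [← Matrix.det_transpose, Matrix.det_apply']
    refine Finset.sum_congr rfl fun σ _ => ?_
    rw [pfaffian_signMatrix_submatrix_of_strictMono hn c.2, mul_comm]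
    rfl
  · exact fun b hb => by rw [pfaffian_signMatrix_submatrix_of_not_injective hb, mul_zero]

theorem maxMinorSum_eq_pfaffian (hn : Even n) (M : Matrix (Fin n) β R) :
    maxMinorSum M = pfaffian (Matrix.of fun i j => maxMinorSum (M.submatrix ![i, j] id)) := by
  rw [maxMinorSum_eq_pfaffian_mul hn]
  congr 1
  ext i j
  rw [Matrix.of_apply, maxMinorSum_eq_pfaffian_mul even_two, pfaffian_fin_two]
  rfl

end MinorSum

end Pfaffian

end Matchings

open Quiver

section LoopErasure

variable {V : Type*} [Quiver V]

theorem mem_vertices_comp {a b c v : V} (p : Path a b) (q : Path b c) :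
    v ∈ (p.comp q).vertices ↔ v ∈ p.vertices ∨ v ∈ q.vertices := by
  induction q with
  | nil => simpa using fun h : v = b => h ▸ p.end_mem_vertices
  | cons q e ih => simp only [Path.comp_cons, Path.mem_vertices_cons, ih, or_assoc]

theorem tail_vertices_cons {a b c : V} (p : Path a b) (e : b ⟶ c) :
    (p.cons e).vertices.tail = p.vertices.tail ++ [c] := by
  rw [Path.vertices_cons, List.concat_eq_append, List.tail_append_of_ne_nil p.vertices_ne_nil]

theorem comp_inj_of_notMem_tail {a v b : V} {p₁ p₂ : Path a v} {q₁ q₂ : Path v b}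
    (h₁ : v ∉ q₁.vertices.tail) (h₂ : v ∉ q₂.vertices.tail) (h : p₁.comp q₁ = p₂.comp q₂) :
    p₁ = p₂ ∧ q₁ = q₂ := by
  suffices q₁ = q₂ from ⟨Path.comp_inj_left.mp (this ▸ h), this⟩
  induction q₁ with
  | nil =>
    cases q₂ with
    | nil => rfl
    | cons q₂ e => exact absurd (tail_vertices_cons _ e ▸ List.mem_concat_self) h₂
  | cons q₁ e ih =>
    cases q₂ with
    | nil => exact absurd (tail_vertices_cons _ e ▸ List.mem_concat_self) h₁
    | cons q₂ e' =>
      simp only [tail_vertices_cons, List.mem_append, not_or] at h₁ h₂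
      obtain ⟨rfl, h, he⟩ := Path.cons.inj h
      rw [ih h₁.1 h₂.1 (eq_of_heq h), eq_of_heq he]

theorem takeWhile_ne_append_cons {α : Type*} [DecidableEq α] {c : α} {l : List α} (h : c ∉ l)
    (t : List α) : (l ++ c :: t).takeWhile (· ≠ c) = l := by
  have hne : ∀ x ∈ l, decide (x ≠ c) = true := fun x hx =>
    decide_eq_true (ne_of_mem_of_not_mem hx h)
  rw [List.takeWhile_append_of_pos hne, List.takeWhile_cons_of_neg (by simp), List.append_nil]

theorem prefix_takeWhile_iff {α : Type*} {P : α → Bool} {l t : List α} :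
    l <+: t.takeWhile P ↔ l <+: t ∧ ∀ u ∈ l, P u := by
  refine ⟨fun h => ⟨h.trans (t.takeWhile_prefix P), fun u hu =>
    List.mem_takeWhile_imp (h.subset hu)⟩, ?_⟩
  rintro ⟨⟨s, rfl⟩, hl⟩
  rw [List.takeWhile_append_of_pos hl]
  exact List.prefix_append _ _

open scoped Classical in
theorem vertices_initialSegment {a : V} : ∀ {b : V} (p : Path a b) (c : V) (h : c ∈ p.vertices),
    (initialSegment p c h).vertices = p.vertices.takeWhile (· ≠ c) ++ [c]
  | _, Path.nil, c, h => by
    obtain rfl : c = a := List.mem_singleton.mp h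
    simp [initialSegment]
  | d, Path.cons p e, c, h => by
    by_cases h' : c ∈ p.vertices
    · obtain ⟨l, t, hl, hc⟩ := List.eq_append_cons_of_mem h'
      rw [initialSegment, dif_pos h', vertices_initialSegment p c h', Path.vertices_cons,
        List.concat_eq_append, hl, List.append_assoc, List.cons_append,
        takeWhile_ne_append_cons hc, takeWhile_ne_append_cons hc]
    · obtain rfl : c = d := ((Path.mem_vertices_cons p e).mp h).resolve_left h'
      rw [initialSegment, dif_neg h', Path.vertices_cons, List.concat_eq_append,
        takeWhile_ne_append_cons h']

open scoped Classical in
theorem vertices_loopErasure_cons {a b c : V} (p : Path a b) (e : b ⟶ c) :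
    (loopErasure (p.cons e)).vertices =
      (loopErasure p).vertices.takeWhile (· ≠ c) ++ [c] := by
  rw [loopErasure]
  split_ifs with h
  · rw [vertices_initialSegment]
  · rw [Path.vertices_cons, List.concat_eq_append, List.takeWhile_eq_self_iff.mpr]
    exact fun u hu => decide_eq_true (ne_of_mem_of_not_mem hu h)

theorem loopErasure_vertices_subset {a b : V} (p : Path a b) :
    (loopErasure p).vertices ⊆ p.vertices := by
  classical
  induction p with
  | nil => exact List.Subset.refl _
  | cons p e ih =>
    rw [vertices_loopErasure_cons, Path.vertices_cons, List.concat_eq_append]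
    exact List.append_subset.mpr ⟨fun u hu =>
      List.mem_append_left _ (ih (List.takeWhile_subset _ hu)), List.subset_append_right _ _⟩

theorem nodup_vertices_loopErasure {a b : V} (p : Path a b) :
    (loopErasure p).vertices.Nodup := by
  classical
  induction p with
  | nil => exact List.nodup_singleton a
  | cons p e ih =>
    rw [vertices_loopErasure_cons, ← List.concat_eq_append, List.nodup_concat]
    exact ⟨fun h => by simpa using List.mem_takeWhile_imp h, ih.sublist (List.takeWhile_sublist _)⟩

theorem concat_prefix_vertices_iff {a v : V} {p : Path a v} (hp : p.vertices.Nodup) {l : List V} :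
    l ++ [v] <+: p.vertices ↔ p.vertices = l ++ [v] := by
  refine ⟨fun h => ?_, fun h => h ▸ List.prefix_rfl⟩
  rw [← p.dropLast_append_end_eq, List.prefix_concat_iff] at h
  rcases h with h | h
  · exact (p.dropLast_append_end_eq ▸ h).symm
  · rw [← p.dropLast_append_end_eq, ← List.concat_eq_append, List.nodup_concat] at hp
    exact absurd (h.subset (by simp)) hp.1

/-- After the last visit to `v`, the walk erases `v` only by returning to a vertex before it. -/
theorem concat_prefix_loopErasure_comp_iff {a v b : V} (p : Path a v) {q : Path v b}
    (hq : v ∉ q.vertices.tail) {l : List V} :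
    l ++ [v] <+: (loopErasure (p.comp q)).vertices ↔
      (loopErasure p).vertices = l ++ [v] ∧ ∀ u ∈ l, u ∉ q.vertices := by
  classical
  induction q with
  | nil =>
    rw [Path.comp_nil, concat_prefix_vertices_iff (nodup_vertices_loopErasure p), iff_self_and]
    intro h u hu hv
    have hnodup := nodup_vertices_loopErasure p
    rw [h, ← List.concat_eq_append, List.nodup_concat] at hnodup
    exact hnodup.1 (List.mem_singleton.mp hv ▸ hu)
  | @cons d c q e ih =>
    simp only [tail_vertices_cons, List.mem_append, List.mem_singleton, not_or] at hq
    have hlast : ∀ t : List V, l ++ [v] ≠ t ++ [c] := fun t h =>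
      hq.2 (by simpa using (List.append_inj' h rfl).2)
    simp only [Path.comp_cons, vertices_loopErasure_cons, List.prefix_concat_iff, hlast, false_or,
      prefix_takeWhile_iff, ih hq.1, Path.mem_vertices_cons, List.forall_mem_append,
      List.forall_mem_singleton, decide_eq_true_eq, not_or, forall_and, hq.2, ne_eq,
      not_false_eq_true, and_true, and_assoc, ← List.forall_mem_ne]

end LoopErasure

section TailExchange

variable {V : Type*} [Quiver V] {ι : Type*} {a : ι → V}

/-- A walk from `u`, with an arbitrary target. -/
abbrev WalkFrom (u : V) : Type _ := Σ v : V, Path u v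

/-- The families `W` and `W'` differ by an exchange of the final parts of the walks `i` and `j`,
both of which are cut at their last visit to `v`. -/
structure TailExchange (W W' : ∀ m, WalkFrom (a m)) (i j : ι) (v : V) : Prop where
  exists_split : ∃ (y z : V) (p : Path (a i) v) (q : Path v y) (p' : Path (a j) v) (q' : Path v z),
    v ∉ q.vertices.tail ∧ v ∉ q'.vertices.tail ∧ W i = ⟨y, p.comp q⟩ ∧ W j = ⟨z, p'.comp q'⟩ ∧
      W' i = ⟨z, p.comp q'⟩ ∧ W' j = ⟨y, p'.comp q⟩
  eq_of_ne : ∀ m, m ≠ i → m ≠ j → W' m = W m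

variable {W W' W₁ W₂ : ∀ m, WalkFrom (a m)} {i j : ι} {v : V}

namespace TailExchange

theorem exists_of_mem (hij : i ≠ j) (hi : v ∈ (W i).2.vertices) (hj : v ∈ (W j).2.vertices) :
    ∃ W', TailExchange W W' i j v := by
  classical
  obtain ⟨p, q, hpq, hq⟩ := (W i).2.exists_eq_comp_and_notMem_tail_of_mem_vertices hi
  obtain ⟨p', q', hpq', hq'⟩ := (W j).2.exists_eq_comp_and_notMem_tail_of_mem_vertices hj
  refine ⟨Function.update (Function.update W i ⟨_, p.comp q'⟩) j ⟨_, p'.comp q⟩,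
    ⟨_, _, p, q, p', q', hq, hq', ?_, ?_, ?_, ?_⟩, fun m hi hj => ?_⟩
  · rw [← hpq]
  · rw [← hpq']
  · rw [Function.update_of_ne hij, Function.update_self]
  · rw [Function.update_self]
  · rw [Function.update_of_ne hj, Function.update_of_ne hi]

protected theorem symm (h : TailExchange W W' i j v) : TailExchange W' W i j v := by
  obtain ⟨⟨y, z, p, q, p', q', hq, hq', h⟩, hne⟩ := h
  exact ⟨⟨z, y, p, q', p', q, hq', hq, h.2.2.1, h.2.2.2, h.1, h.2.1⟩,
    fun m hi hj => (hne m hi hj).symm⟩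

protected theorem unique (h₁ : TailExchange W W₁ i j v) (h₂ : TailExchange W W₂ i j v) :
    W₁ = W₂ := by
  obtain ⟨⟨y₁, z₁, p₁, q₁, p₁', q₁', hq₁, hq₁', hi₁, hj₁, hi₁', hj₁'⟩, hne₁⟩ := h₁
  obtain ⟨⟨y₂, z₂, p₂, q₂, p₂', q₂', hq₂, hq₂', hi₂, hj₂, hi₂', hj₂'⟩, hne₂⟩ := h₂
  obtain ⟨rfl, hi⟩ := Sigma.mk.inj (hi₁.symm.trans hi₂)
  obtain ⟨rfl, hj⟩ := Sigma.mk.inj (hj₁.symm.trans hj₂)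
  obtain ⟨rfl, rfl⟩ := comp_inj_of_notMem_tail hq₁ hq₂ (eq_of_heq hi)
  obtain ⟨rfl, rfl⟩ := comp_inj_of_notMem_tail hq₁' hq₂' (eq_of_heq hj)
  funext m
  by_cases hmi : m = i
  · rw [hmi, hi₁', hi₂']
  by_cases hmj : m = j
  · rw [hmj, hj₁', hj₂']
  rw [hne₁ m hmi hmj, hne₂ m hmi hmj]

theorem mem_vertices (h : TailExchange W W' i j v) {m : ι} {u : V} (hu : u ∈ (W' m).2.vertices) :
    u ∈ (W m).2.vertices ∨ u ∈ (W i).2.vertices ∨ u ∈ (W j).2.vertices := by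
  obtain ⟨⟨y, z, p, q, p', q', -, -, hi, hj, hi', hj'⟩, hne⟩ := h
  by_cases hmi : m = i
  · subst hmi
    rw [hi', mem_vertices_comp] at hu
    rw [hi, hj, mem_vertices_comp, mem_vertices_comp]
    tauto
  by_cases hmj : m = j
  · subst hmj
    rw [hj', mem_vertices_comp] at hu
    rw [hi, hj, mem_vertices_comp, mem_vertices_comp]
    tauto
  exact Or.inl (hne m hmi hmj ▸ hu)

theorem mem_vertices_right (h : TailExchange W W' i j v) : v ∈ (W j).2.vertices := by
  obtain ⟨⟨y, z, p, q, p', q', -, -, -, hj, -, -⟩, -⟩ := h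
  rw [hj, mem_vertices_comp]
  exact Or.inl p'.end_mem_vertices

theorem concat_prefix_loopErasure (h : TailExchange W W' i j v) {l : List V}
    (hl : l ++ [v] <+: (loopErasure (W i).2).vertices) (hlj : ∀ u ∈ l, u ∉ (W j).2.vertices) :
    l ++ [v] <+: (loopErasure (W' i).2).vertices ∧ ∀ u ∈ l, u ∉ (W' j).2.vertices := by
  obtain ⟨⟨y, z, p, q, p', q', hq, hq', hi, hj, hi', hj'⟩, -⟩ := h
  rw [hj] at hlj
  simp only [mem_vertices_comp, not_or] at hlj
  rw [hi, concat_prefix_loopErasure_comp_iff p hq] at hl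
  rw [hi', hj', concat_prefix_loopErasure_comp_iff p hq']
  refine ⟨⟨hl.1, fun u hu => (hlj u hu).2⟩, fun u hu => ?_⟩
  rw [mem_vertices_comp, not_or]
  exact ⟨(hlj u hu).1, hl.2 u hu⟩

theorem fst_eq [DecidableEq ι] (h : TailExchange W W' i j v) (m : ι) :
    (W' m).1 = (W (Equiv.swap i j m)).1 := by
  obtain ⟨⟨y, z, p, q, p', q', -, -, hi, hj, hi', hj'⟩, hne⟩ := h
  by_cases hmi : m = i
  · rw [hmi, Equiv.swap_apply_left, hi', hj]
  by_cases hmj : m = j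
  · rw [hmj, Equiv.swap_apply_right, hj', hi]
  rw [Equiv.swap_apply_of_ne_of_ne hmi hmj, hne m hmi hmj]

theorem prod_weight [Fintype ι] {R : Type*} [CommMonoid R] (wt : ∀ {u v : V}, (u ⟶ v) → R)
    (h : TailExchange W W' i j v) (hij : i ≠ j) :
    ∏ m, (W' m).2.weight wt = ∏ m, (W m).2.weight wt := by
  classical
  obtain ⟨⟨y, z, p, q, p', q', -, -, hi, hj, hi', hj'⟩, hne⟩ := h
  rw [← Finset.prod_mul_prod_compl {i, j}, ← Finset.prod_mul_prod_compl {i, j}]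
  congr 1
  · rw [Finset.prod_pair hij, Finset.prod_pair hij, hi, hj, hi', hj']
    simp only [Path.weight_comp]
    rw [mul_mul_mul_comm, mul_comm (q'.weight wt), mul_mul_mul_comm]
  · refine Finset.prod_congr rfl fun m hm => ?_
    simp only [Finset.mem_compl, Finset.mem_insert, Finset.mem_singleton, not_or] at hm
    rw [hne m hm.1 hm.2]

end TailExchange

end TailExchange

section FirstCrossing

theorem find?_eq_some_iff_prefix {α : Type*} {P : α → Prop} [DecidablePred P] {L : List α}
    {v : α} : L.find? (P ·) = some v ↔ P v ∧ ∃ l, l ++ [v] <+: L ∧ ∀ u ∈ l, ¬P u := by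
  rw [List.find?_eq_some_iff_append, decide_eq_true_eq]
  refine and_congr_right fun _ => exists_congr fun l => ?_
  simp only [List.IsPrefix, List.append_assoc, List.singleton_append, eq_comm (a := L),
    ← exists_and_right, Bool.not_eq_true', decide_eq_false_iff_not]

variable {V : Type*} [Quiver V] {ι : Type*} [LinearOrder ι] {a : ι → V}

/-- No walk with an index larger than `i` meets the loop-erasure of the walk with index `i`. -/
def ErasureAvoided (W : ∀ m, WalkFrom (a m)) (i : ι) : Prop :=
  ∀ m, i < m → VertexDisjoint (W m).2 (loopErasure (W i).2)

open scoped Classical in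
/-- The place where a family of walks first fails to be in `Walk_k`: `i` is the first index whose
loop-erasure is met by a later walk, `v` is the first vertex of this loop-erasure which a later walk
visits, and `j` is the first later index whose walk visits `v`. -/
structure IsFirstCrossing (W : ∀ m, WalkFrom (a m)) (i j : ι) (v : V) : Prop where
  isLeast_left : IsLeast {m | ¬ErasureAvoided W m} i
  find?_eq : (loopErasure (W i).2).vertices.find? (∃ m, i < m ∧ · ∈ (W m).2.vertices) = some v
  isLeast_right : IsLeast {m | i < m ∧ v ∈ (W m).2.vertices} j

variable {W W' W₁ W₂ : ∀ m, WalkFrom (a m)} {i j i₁ j₁ i₂ j₂ : ι} {v v₁ v₂ : V}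

theorem exists_isFirstCrossing [WellFoundedLT ι] (h : ∃ i, ¬ErasureAvoided W i) :
    ∃ i j v, IsFirstCrossing W i j v := by
  classical
  obtain ⟨i, hi⟩ := exists_minimal_of_wellFoundedLT _ h
  obtain ⟨m, hm, u, hu, hu'⟩ : ∃ m, i < m ∧ ∃ u ∈ (W m).2.vertices,
      u ∈ (loopErasure (W i).2).vertices := by
    simpa only [ErasureAvoided, VertexDisjoint, not_forall, not_not, exists_prop] using hi.prop
  obtain ⟨v, hv⟩ : ∃ v, (loopErasure (W i).2).vertices.find?
      (∃ m, i < m ∧ · ∈ (W m).2.vertices) = some v := by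
    rw [← Option.isSome_iff_exists, List.find?_isSome]
    exact ⟨u, hu', decide_eq_true ⟨m, hm, hu⟩⟩
  obtain ⟨j, hj⟩ := exists_minimal_of_wellFoundedLT _ (find?_eq_some_iff_prefix.mp hv).1
  exact ⟨i, j, v, minimal_iff_isLeast.mp hi, hv, minimal_iff_isLeast.mp hj⟩

namespace IsFirstCrossing

protected theorem unique (h₁ : IsFirstCrossing W i₁ j₁ v₁) (h₂ : IsFirstCrossing W i₂ j₂ v₂) :
    i₁ = i₂ ∧ j₁ = j₂ ∧ v₁ = v₂ := by
  obtain rfl := h₁.isLeast_left.unique h₂.isLeast_left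
  obtain rfl := Option.some_injective _ (h₁.find?_eq.symm.trans h₂.find?_eq)
  exact ⟨rfl, h₁.isLeast_right.unique h₂.isLeast_right, rfl⟩

theorem lt (h : IsFirstCrossing W i j v) : i < j :=
  h.isLeast_right.1.1

theorem mem_left (h : IsFirstCrossing W i j v) : v ∈ (W i).2.vertices := by
  classical
  exact loopErasure_vertices_subset _ (List.mem_of_find?_eq_some h.find?_eq)

theorem erasureAvoided_tailExchange (h : IsFirstCrossing W i j v)
    (hW : TailExchange W W' i j v) {m : ι} (hm : m < i) : ErasureAvoided W' m := by
  have hmW : ErasureAvoided W m := not_not.mp fun hbad => (h.isLeast_left.2 hbad).not_gt hm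
  intro n hn u hu
  rw [hW.eq_of_ne m hm.ne (hm.trans h.lt).ne]
  rcases hW.mem_vertices hu with hu | hu | hu
  · exact hmW n hn u hu
  · exact hmW i hm u hu
  · exact hmW j (hm.trans h.lt) u hu

protected theorem tailExchange (h : IsFirstCrossing W i j v) (hW : TailExchange W W' i j v) :
    IsFirstCrossing W' i j v := by
  classical
  obtain ⟨-, l, hl, hlW⟩ := find?_eq_some_iff_prefix.mp h.find?_eq
  obtain ⟨hl', hlj⟩ := hW.concat_prefix_loopErasure hl fun u hu huj => hlW u hu ⟨j, h.lt, huj⟩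
  have hj : i < j ∧ v ∈ (W' j).2.vertices := ⟨h.lt, hW.symm.mem_vertices_right⟩
  refine ⟨⟨fun havoid => havoid j hj.1 v hj.2 (hl'.subset (by simp)), fun m hm => ?_⟩,
    find?_eq_some_iff_prefix.mpr ⟨⟨j, hj⟩, l, hl', ?_⟩, hj, fun m hm => ?_⟩
  · exact le_of_not_gt fun hmi => hm (h.erasureAvoided_tailExchange hW hmi)
  · rintro u hu ⟨m, hm, hum⟩
    by_cases hmj : m = j
    · exact hlj u hu (hmj ▸ hum)
    · exact hlW u hu ⟨m, hm, hW.eq_of_ne m hm.ne' hmj ▸ hum⟩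
  · by_contra hmj
    exact hmj (h.isLeast_right.2 ⟨hm.1, hW.eq_of_ne m hm.1.ne' (lt_of_not_ge hmj).ne ▸ hm.2⟩)

end IsFirstCrossing

end FirstCrossing

section SignReversing

theorem hasSum_sigma_of_fintype {ι M : Type*} [Fintype ι] {α : ι → Type*} [AddCommMonoid M]
    [TopologicalSpace M] [ContinuousAdd M] {f : (Σ i, α i) → M} {s : ι → M}
    (h : ∀ i, HasSum (fun x => f ⟨i, x⟩) (s i)) : HasSum f (∑ i, s i) := by
  classical
  have hfiber : ∀ i, HasSum (fun y : Σ i, α i => if y.1 = i then f y else 0) (s i) := by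
    intro i
    rw [← sigma_mk_injective.hasSum_iff (g := Sigma.mk i)]
    · simpa [Function.comp_def] using h i
    · rintro ⟨j, x⟩ hx
      exact if_neg fun hji : j = i => hx (hji ▸ ⟨x, rfl⟩)
  simpa using hasSum_sum fun i (_ : i ∈ Finset.univ) => hfiber i

/-- The summability assumption concerns only half of the index set, since in a ring that is not
complete a subfamily of a summable family need not be summable. -/
theorem hasSum_zero_of_signReversing {Y R : Type*} [Ring R] [TopologicalSpace R]
    [IsTopologicalRing R] {s : Y → ℤˣ} {f : Y → R} {g : Y → Y} (hg : Function.Involutive g)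
    (hs : ∀ y, s (g y) = -s y) (hf : ∀ y, f (g y) = f y)
    (hsum : Summable fun y : {y | s y = 1} => f y) :
    HasSum (fun y => ((s y : ℤ) : R) * f y) 0 := by
  set F : Y → R := fun y => ((s y : ℤ) : R) * f y
  let e : {y | s y = 1} ≃ ({y | s y = 1}ᶜ : Set Y) :=
    hg.toPerm.subtypeEquiv fun y => by
      rcases Int.units_eq_one_or (s y) with h | h <;> simp [hs, h]
  have hF : F ∘ ((↑) : {y | s y = 1} → Y) = fun y : {y | s y = 1} => f y := funext fun y => by
    simp [F, show s y = 1 from y.2]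
  have hFe : (F ∘ (↑)) ∘ e = fun y : {y | s y = 1} => -f y := funext fun y => by
    simp [F, e, hs, hf, show s y = 1 from y.2]
  have hpos : HasSum (F ∘ ((↑) : {y | s y = 1} → Y)) (∑' y : {y | s y = 1}, f y) :=
    hF ▸ hsum.hasSum
  have hneg : HasSum (F ∘ ((↑) : ({y | s y = 1}ᶜ : Set Y) → Y)) (-∑' y : {y | s y = 1}, f y) :=
    e.hasSum_iff.mp (hFe ▸ hsum.hasSum.neg)
  simpa only [add_neg_cancel] using hpos.add_compl hneg

end SignReversing

section Determinant

variable {V : Type*} [Quiver V] {k : ℕ}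

/-- The walks of a family with sources `a`, without recording their targets in the type. -/
def forgetTargets {a b : Fin k → V} (w : AllFamilies a b) : ∀ m, WalkFrom (a m) :=
  fun m => ⟨b m, w m⟩

theorem forgetTargets_injective {a b : Fin k → V} :
    Function.Injective (forgetTargets (a := a) (b := b)) := fun _ _ h =>
  funext fun m => eq_of_heq (Sigma.mk.inj (congrFun h m)).2

theorem exists_forgetTargets_eq {a b : Fin k → V} {W : ∀ m, WalkFrom (a m)}
    (hb : ∀ m, (W m).1 = b m) : ∃ w : AllFamilies a b, forgetTargets w = W := by
  obtain rfl : (fun m => (W m).1) = b := funext hb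
  exact ⟨fun m => (W m).2, rfl⟩

/-- The condition that defines `WalkFamilies`, as a set of families of walks. -/
def erasureDisjointFamilies (a b : Fin k → V) : Set (AllFamilies a b) :=
  {w | ∀ i j, i < j → VertexDisjoint (w j) (loopErasure (w i))}

theorem mem_compl_erasureDisjointFamilies_iff {a b : Fin k → V} {w : AllFamilies a b} :
    w ∈ (erasureDisjointFamilies a b)ᶜ ↔ ∃ i, ¬ErasureAvoided (forgetTargets w) i :=
  not_forall

/-- The families of walks from `a` to a permutation of `b` which are not in `WalkFamilies`. -/
abbrev CrossingFamilies (a b : Fin k → V) : Type _ :=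
  Σ σ : Equiv.Perm (Fin k), ((erasureDisjointFamilies a (b ∘ σ))ᶜ : Set _)

/-- Exchanging the tails of two walks at the first crossing of a family. -/
def FirstCrossingExchange {a b : Fin k → V} (y z : CrossingFamilies a b) (i j : Fin k) : Prop :=
  z.1 = y.1 * Equiv.swap i j ∧ ∃ v, IsFirstCrossing (forgetTargets y.2.1) i j v ∧
    TailExchange (forgetTargets y.2.1) (forgetTargets z.2.1) i j v

namespace FirstCrossingExchange

variable {a b : Fin k → V} {y z z₁ z₂ : CrossingFamilies a b} {i j i₁ j₁ i₂ j₂ : Fin k}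

theorem exists_of_crossing (y : CrossingFamilies a b) :
    ∃ z i j, FirstCrossingExchange y z i j := by
  obtain ⟨σ, w, hw⟩ := y
  obtain ⟨i, j, v, hc⟩ := exists_isFirstCrossing (mem_compl_erasureDisjointFamilies_iff.mp hw)
  obtain ⟨W', hW'⟩ := TailExchange.exists_of_mem hc.lt.ne hc.mem_left hc.isLeast_right.1.2
  obtain ⟨w', rfl⟩ := exists_forgetTargets_eq (b := b ∘ (σ * Equiv.swap i j)) hW'.fst_eq
  have hw' := mem_compl_erasureDisjointFamilies_iff.mpr ⟨i, (hc.tailExchange hW').isLeast_left.1⟩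
  exact ⟨⟨_, w', hw'⟩, i, j, rfl, v, hc, hW'⟩

protected theorem symm (h : FirstCrossingExchange y z i j) : FirstCrossingExchange z y i j := by
  obtain ⟨hσ, v, hc, hW⟩ := h
  exact ⟨by rw [hσ, Equiv.mul_swap_mul_self], v, hc.tailExchange hW, hW.symm⟩

protected theorem unique (h₁ : FirstCrossingExchange y z₁ i₁ j₁)
    (h₂ : FirstCrossingExchange y z₂ i₂ j₂) : z₁ = z₂ := by
  obtain ⟨τ₁, w₁, hw₁⟩ := z₁
  obtain ⟨τ₂, w₂, hw₂⟩ := z₂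
  obtain ⟨rfl, v₁, hc₁, hW₁⟩ := h₁
  obtain ⟨hτ, v₂, hc₂, hW₂⟩ := h₂
  obtain ⟨rfl, rfl, rfl⟩ := hc₁.unique hc₂
  obtain rfl : τ₂ = _ := hτ
  obtain rfl : w₁ = w₂ := forgetTargets_injective (hW₁.unique hW₂)
  rfl

theorem sign_eq (h : FirstCrossingExchange y z i j) :
    Equiv.Perm.sign z.1 = -Equiv.Perm.sign y.1 := by
  obtain ⟨hσ, v, hc, -⟩ := h
  rw [hσ, Equiv.Perm.sign_mul, Equiv.Perm.sign_swap hc.lt.ne, mul_neg_one]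

theorem familyWeight_eq {R : Type*} [CommRing R] (wt : ∀ {u v : V}, (u ⟶ v) → R)
    (h : FirstCrossingExchange y z i j) : familyWeight wt z.2.1 = familyWeight wt y.2.1 := by
  obtain ⟨-, v, hc, hW⟩ := h
  exact hW.prod_weight wt hc.lt.ne

theorem exists_involutive (a b : Fin k → V) :
    ∃ g : CrossingFamilies a b → CrossingFamilies a b, Function.Involutive g ∧
      ∀ y, ∃ i j, FirstCrossingExchange y (g y) i j := by
  choose g i j hg using exists_of_crossing (a := a) (b := b)
  exact ⟨g, fun y => (hg (g y)).unique (hg y).symm, fun y => ⟨i y, j y, hg y⟩⟩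

end FirstCrossingExchange

variable {R : Type*} [CommRing R] [TopologicalSpace R] [IsTopologicalRing R] [T2Space R]
  (wt : ∀ {u v : V}, (u ⟶ v) → R)

theorem sum_sign_mul_tsum_crossing_eq_zero (a b : Fin k → V)
    (hsum : ∀ σ : Equiv.Perm (Fin k), Summable fun w :
      ((erasureDisjointFamilies a (b ∘ σ))ᶜ : Set _) => familyWeight wt w.1) :
    ∑ σ : Equiv.Perm (Fin k), ((Equiv.Perm.sign σ : ℤ) : R) *
      ∑' w : ((erasureDisjointFamilies a (b ∘ σ))ᶜ : Set _), familyWeight wt w.1 = 0 := by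
  classical
  obtain ⟨g, hg, hex⟩ := FirstCrossingExchange.exists_involutive a b
  have heven : Summable fun y : {y : CrossingFamilies a b | Equiv.Perm.sign y.1 = 1} =>
      familyWeight wt y.1.2.1 := by
    have hindicator : HasSum ({y : CrossingFamilies a b | Equiv.Perm.sign y.1 = 1}.indicator
        fun y => familyWeight wt y.2.1) (∑ σ : Equiv.Perm (Fin k), if Equiv.Perm.sign σ = 1 then
          ∑' w : ((erasureDisjointFamilies a (b ∘ σ))ᶜ : Set _), familyWeight wt w.1 else 0) := by
      refine hasSum_sigma_of_fintype fun σ => ?_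
      by_cases hσ : Equiv.Perm.sign σ = 1
      · simpa only [Set.indicator_apply, Set.mem_ofPred_eq, hσ, if_true] using (hsum σ).hasSum
      · simpa only [Set.indicator_apply, Set.mem_ofPred_eq, hσ, if_false] using hasSum_zero
    exact (summable_subtype_iff_indicator (f := fun y : CrossingFamilies a b =>
      familyWeight wt y.2.1)).mpr hindicator.summable
  have hzero : HasSum (fun y : CrossingFamilies a b =>
      ((Equiv.Perm.sign y.1 : ℤ) : R) * familyWeight wt y.2.1) 0 :=
    hasSum_zero_of_signReversing hg (fun y => (hex y).elim fun i ⟨j, h⟩ => h.sign_eq)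
      (fun y => (hex y).elim fun i ⟨j, h⟩ => h.familyWeight_eq wt) heven
  refine HasSum.unique ?_ hzero
  exact hasSum_sigma_of_fintype fun σ => (hsum σ).hasSum.mul_left _

theorem hasSum_pi_prod {β : Fin k → Type*} {f : ∀ i, β i → R}
    (h : ∀ (m : ℕ) (ι : Fin m ↪ Fin k),
      Summable fun x : ∀ i, β (ι i) => ∏ i, f (ι i) (x i)) :
    HasSum (fun x : ∀ i, β i => ∏ i, f i (x i)) (∏ i, ∑' y, f i y) := by
  induction k with
  | zero =>
    simpa only [Finset.univ_eq_empty, Finset.prod_empty] using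
      hasSum_unique fun _ : ∀ i, β i => (1 : R)
  | succ k ih =>
    let single : Fin 1 ↪ Fin (k + 1) := ⟨fun _ => 0, Function.injective_of_subsingleton _⟩
    have hhead : Summable (f 0) := by
      refine ((Equiv.piUnique fun i => β (single i)).summable_iff.mp ?_)
      simpa [Function.comp_def, single] using h 1 single
    have htail := ih (f := fun i => f i.succ) fun m ι => h m (ι.trans (Fin.succEmb k))
    have hcons : Summable fun x : β 0 × (∀ i : Fin k, β i.succ) =>
        f 0 x.1 * ∏ i, f i.succ (x.2 i) := by
      refine ((Fin.consEquiv β).summable_iff.mpr (h (k + 1) (.refl _))).congr fun x => ?_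
      exact Fin.prod_univ_succ _
    rw [Fin.prod_univ_succ, ← (Fin.consEquiv β).hasSum_iff]
    simpa [Function.comp_def, Fin.prod_univ_succ] using hhead.hasSum.mul htail hcons

/-- The total weight of the walks from `u` to `v`, which is `0` if the sum does not converge. -/
noncomputable def walkSum (u v : V) : R := ∑' p : Path u v, p.weight wt

/-- The matrix of the total weights of the walks from the entries of `a` to the vertices in `B`. -/
noncomputable def walkMatrix (B : Set V) (a : Fin k → V) : Matrix (Fin k) B R :=
  Matrix.of fun i b => walkSum wt (a i) b

variable {B : Set V} {a : Fin k → V}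

theorem signedWalkSum_eq_det (hW : WalkSumsConverge wt B a)
    (hfamilies : ∀ b : Fin k → B,
      Summable fun w : WalkFamilies a (fun i => (b i : V)) => familyWeight wt w.1)
    (b : Fin k → B) :
    signedWalkSum wt a (fun i => (b i : V)) = ((walkMatrix wt B a).submatrix id b).det := by
  set b' : Fin k → V := fun i => (b i : V)
  have hall : ∀ σ : Equiv.Perm (Fin k), HasSum (fun w : AllFamilies a (b' ∘ σ) =>
      familyWeight wt w) (∏ i, walkSum wt (a i) (b (σ i))) := fun σ =>
    hasSum_pi_prod fun m ι => hW m ι fun i => b (σ (ι i))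
  have hdisjoint : ∀ σ : Equiv.Perm (Fin k), Summable
      fun w : erasureDisjointFamilies a (b' ∘ σ) => familyWeight wt w.1 := fun σ =>
    hfamilies (b ∘ σ)
  have hcrossing : ∀ σ : Equiv.Perm (Fin k), Summable
      fun w : ((erasureDisjointFamilies a (b' ∘ σ))ᶜ : Set _) => familyWeight wt w.1 := fun σ =>
    (Summable.summable_compl_iff (f := fun w => familyWeight wt w) (hdisjoint σ)).mpr
      (hall σ).summable
  calc signedWalkSum wt a b'
      = ∑ σ : Equiv.Perm (Fin k), ((Equiv.Perm.sign σ : ℤ) : R) *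
          ∑' w : erasureDisjointFamilies a (b' ∘ σ), familyWeight wt w.1 := rfl
    _ = ∑ σ : Equiv.Perm (Fin k), ((Equiv.Perm.sign σ : ℤ) : R) *
          (∑' w : erasureDisjointFamilies a (b' ∘ σ), familyWeight wt w.1 +
            ∑' w : ((erasureDisjointFamilies a (b' ∘ σ))ᶜ : Set _), familyWeight wt w.1) := by
      simp only [mul_add, Finset.sum_add_distrib,
        sum_sign_mul_tsum_crossing_eq_zero wt a b' hcrossing, add_zero]
    _ = ∑ σ : Equiv.Perm (Fin k), ((Equiv.Perm.sign σ : ℤ) : R) *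
          ∏ i, walkSum wt (a i) (b (σ i)) :=
      Finset.sum_congr rfl fun σ _ => congrArg _ <|
        (Summable.tsum_add_tsum_compl (f := fun w => familyWeight wt w)
          (hdisjoint σ) (hcrossing σ)).trans (hall σ).tsum_eq
    _ = ((walkMatrix wt B a).submatrix id b).det := by
      rw [← Matrix.det_transpose, Matrix.det_apply']
      rfl

end Determinant

section Pairs

variable {V : Type*} [Quiver V] {R : Type*} [CommRing R] [TopologicalSpace R]
  (wt : ∀ {u v : V}, (u ⟶ v) → R) {B : Set V} {k : ℕ} {a : Fin k → V}

theorem comp_vecCons_pair {ι α : Type*} (a : ι → α) (i j : ι) : a ∘ ![i, j] = ![a i, a j] := by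
  ext m
  fin_cases m <;> rfl

theorem WalkSumsConverge.pair (hW : WalkSumsConverge wt B a) {i j : Fin k} (hij : i ≠ j) :
    WalkSumsConverge wt B ![a i, a j] := by
  rw [← comp_vecCons_pair]
  exact fun m ι b => hW m (ι.trans ⟨![i, j], injective_pair_iff_ne.mpr hij⟩) b

theorem isEmpty_walkFamilies_pair (u : V) (b : Fin 2 → V) : IsEmpty (WalkFamilies ![u, u] b) :=
  ⟨fun w => w.2 0 1 Fin.zero_lt_one u (w.1 1).start_mem_vertices
    (loopErasure (w.1 0)).start_mem_vertices⟩

theorem walkQ_pair_self (B : Set V) [LinearOrder B] (u : V) : walkQ wt B ![u, u] = 0 := by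
  simp [walkQ, signedWalkSum, isEmpty_walkFamilies_pair]

variable [IsTopologicalRing R] [T2Space R]

theorem signedWalkSum_pair_eq_det (hW : WalkSumsConverge wt B a) {i j : Fin k} (hij : i ≠ j)
    (hfamilies : ∀ b : Fin 2 → B,
      Summable fun w : WalkFamilies ![a i, a j] (fun i => (b i : V)) => familyWeight wt w.1)
    (b : Fin 2 → B) :
    signedWalkSum wt ![a i, a j] (fun m => (b m : V)) =
      ((walkMatrix wt B a).submatrix ![i, j] b).det := by
  rw [signedWalkSum_eq_det wt (hW.pair wt hij) hfamilies, ← comp_vecCons_pair]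
  rfl

theorem walkQ_pair_swap [LinearOrder B] (hW : WalkSumsConverge wt B a)
    (hQ₂ : ∀ i j, QSumsConverge wt B ![a i, a j]) (i j : Fin k) :
    walkQ wt B ![a j, a i] = -walkQ wt B ![a i, a j] := by
  rcases eq_or_ne i j with rfl | hij
  · rw [walkQ_pair_self, neg_zero]
  · simp only [walkQ, signedWalkSum_pair_eq_det wt hW hij (hQ₂ i j).families,
      signedWalkSum_pair_eq_det wt hW hij.symm (hQ₂ j i).families, ← tsum_neg]
    refine tsum_congr fun b => ?_
    simp only [Matrix.det_fin_two, Matrix.submatrix_apply, Matrix.cons_val_zero,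
      Matrix.cons_val_one]
    ring

end Pairs

section Limit

open Filter Topology

theorem tendsto_sum_strictMono {R β : Type*} [AddCommMonoid R] [TopologicalSpace R]
    [LinearOrder β] {k : ℕ} {F : (Fin k → β) → R}
    (hF : Summable fun b : {b : Fin k → β // StrictMono b} => F b.1) :
    Tendsto (fun S : Finset β => ∑ c : {c : Fin k → S // StrictMono c}, F fun i => (c.1 i : β))
      atTop (𝓝 (∑' b : {b : Fin k → β // StrictMono b}, F b.1)) := by
  let E (S : Finset β) :
      {c : Fin k → S // StrictMono c} ↪ {b : Fin k → β // StrictMono b} :=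
    ⟨fun c => ⟨fun i => (c.1 i : β), fun i j hij => c.2 hij⟩, fun c d h =>
      Subtype.ext (Subtype.val_injective.comp_left (congrArg Subtype.val h))⟩
  have hE : ∀ S b, b ∈ Finset.univ.map (E S) ↔ ∀ i, b.1 i ∈ S := by
    intro S b
    rw [Finset.mem_map]
    constructor
    · rintro ⟨c, -, rfl⟩ i
      exact (c.1 i).2
    · exact fun h => ⟨⟨fun i => ⟨b.1 i, h i⟩, fun i j hij => b.2 hij⟩, Finset.mem_univ _, rfl⟩
  have hlim : Tendsto (fun S : Finset β => Finset.univ.map (E S)) atTop atTop := by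
    refine tendsto_atTop_finset_of_monotone (fun S T hST b hb => ?_) fun b => ?_
    · exact (hE T b).mpr fun i => hST ((hE S b).mp hb i)
    · exact ⟨Finset.univ.image b.1, (hE _ _).mpr fun i =>
        Finset.mem_image_of_mem _ (Finset.mem_univ i)⟩
  exact (hF.hasSum.comp hlim :).congr fun S => Finset.sum_map _ _ _

theorem tendsto_pfaffian {R X : Type*} [CommRing R] [TopologicalSpace R] [IsTopologicalRing R]
    {k : ℕ} {l : Filter X} {M : X → Matrix (Fin k) (Fin k) R} {N : Matrix (Fin k) (Fin k) R}
    (h : ∀ i j, i ≠ j → Tendsto (fun x => M x i j) l (𝓝 (N i j))) :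
    Tendsto (fun x => pfaffian (M x)) l (𝓝 (pfaffian N)) :=
  tendsto_finsetSum _ fun f _ => tendsto_const_nhds.mul <|
    tendsto_finsetProd _ fun i _ => h i (f.1 i) (f.2 i).2.symm

variable {V : Type*} [Quiver V] {R : Type*} [CommRing R] [TopologicalSpace R]
  [IsTopologicalRing R] [T2Space R] (wt : ∀ {u v : V}, (u ⟶ v) → R) {B : Set V}
  [LinearOrder B] {k : ℕ} {a : Fin k → V}

theorem tendsto_maxMinorSum_walkMatrix (hW : WalkSumsConverge wt B a)
    (hQ : QSumsConverge wt B a) :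
    Tendsto (fun S : Finset B => maxMinorSum ((walkMatrix wt B a).submatrix id ((↑) : S → B)))
      atTop (𝓝 (walkQ wt B a)) :=
  (tendsto_sum_strictMono (F := fun b : Fin k → B => signedWalkSum wt a fun i => (b i : V))
    hQ.tuples).congr fun _ => Finset.sum_congr rfl fun c _ =>
      signedWalkSum_eq_det wt hW hQ.families fun i => (c.1 i : B)

theorem tendsto_maxMinorSum_walkMatrix_pair (hW : WalkSumsConverge wt B a) {i j : Fin k}
    (hij : i ≠ j) (hQ₂ : QSumsConverge wt B ![a i, a j]) :
    Tendsto (fun S : Finset B =>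
        maxMinorSum ((walkMatrix wt B a).submatrix ![i, j] ((↑) : S → B)))
      atTop (𝓝 (walkQ wt B ![a i, a j])) := by
  refine (tendsto_maxMinorSum_walkMatrix wt (hW.pair wt hij) hQ₂).congr fun S => ?_
  rw [← comp_vecCons_pair]
  rfl

theorem walkQ_eq_pfaffian (hk : Even k) (hW : WalkSumsConverge wt B a)
    (hQ : QSumsConverge wt B a) (hQ₂ : ∀ i j, QSumsConverge wt B ![a i, a j]) :
    walkQ wt B a = pfaffian (Matrix.of fun i j => walkQ wt B ![a i, a j]) := by
  refine tendsto_nhds_unique (tendsto_maxMinorSum_walkMatrix wt hW hQ) ?_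
  simp only [maxMinorSum_eq_pfaffian hk]
  exact tendsto_pfaffian fun i j hij =>
    tendsto_maxMinorSum_walkMatrix_pair wt hW hij (hQ₂ i j)

end Limit

section Acyclic

variable {V : Type*} [Quiver V]

theorem IsAcyclic.notMem_vertices_of_hom (hV : IsAcyclic V) {a b c : V} (p : Path a b)
    (e : b ⟶ c) : c ∉ p.vertices := by
  intro hc
  obtain ⟨-, q, -⟩ := p.exists_eq_comp_of_mem_vertices hc
  exact q.cons_ne_nil e (hV c (q.cons e))

theorem IsAcyclic.loopErasure_eq (hV : IsAcyclic V) {a b : V} (p : Path a b) :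
    loopErasure p = p := by
  induction p with
  | nil => rfl
  | cons p e ih => rw [loopErasure, ih, dif_neg (hV.notMem_vertices_of_hom p e)]

theorem IsAcyclic.nodup_vertices (hV : IsAcyclic V) {a b : V} (p : Path a b) :
    p.vertices.Nodup :=
  hV.loopErasure_eq p ▸ nodup_vertices_loopErasure p

variable {R : Type*} [CommRing R] [TopologicalSpace R] (wt : ∀ {u v : V}, (u ⟶ v) → R)

theorem IsAcyclic.pathQ_eq_walkQ (hV : IsAcyclic V) (B : Set V) [LinearOrder B] {k : ℕ}
    (a : Fin k → V) : pathQ wt B a = walkQ wt B a := by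
  refine tsum_congr fun b => Finset.sum_congr rfl fun σ _ => congrArg _ ?_
  refine (Equiv.subtypeEquivRight fun w => ?_).tsum_eq
    (fun w : WalkFamilies a ((fun i => (b.1 i : V)) ∘ σ) => familyWeight wt w.1)
  simp only [hV.loopErasure_eq]
  refine ⟨fun h i j hij => h.2 j i hij.ne',
    fun h => ⟨fun i => hV.nodup_vertices _, fun i j hij => ?_⟩⟩
  rcases lt_or_gt_of_ne hij with hij | hij
  · exact fun v hi hj => h i j hij v hj hi
  · exact h j i hij

end Acyclic

end LoopErasedWalks

open LoopErasedWalks in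
/-- Let `G` be a directed graph on `V` with edge weights in a Hausdorff commutative topological ring
(any commutative ring with the discrete topology, if all sums are finite), and let `B` be an ordered
set of vertices. For even `k` and every `k`-tuple `a` of vertices for which the sums involved
converge, the matrix `Q̃₂(a_i, a_j)` is skew-symmetric with zero diagonal and its Pfaffian is
`Q̃_k(a)`. If `G` is acyclic, the Pfaffian identity also holds with families of pairwise disjoint
paths in place of loop-erasure-disjoint families of walks. -/
theorem mainTheorem2 {V : Type*} [Quiver V] {R : Type*} [CommRing R] [TopologicalSpace R]
    [IsTopologicalRing R] [T2Space R] (wt : ∀ {u v : V}, (u ⟶ v) → R)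
    (B : Set V) [LinearOrder B] {k : ℕ} (hk : Even k) (a : Fin k → V)
    (hW : WalkSumsConverge wt B a) (hQ : QSumsConverge wt B a)
    (hQ₂ : ∀ i j, QSumsConverge wt B ![a i, a j]) :
    (∀ i, walkQ wt B ![a i, a i] = 0) ∧
    (∀ i j, walkQ wt B ![a j, a i] = - walkQ wt B ![a i, a j]) ∧
    walkQ wt B a = pfaffian (Matrix.of fun i j => walkQ wt B ![a i, a j]) ∧
    (IsAcyclic V →
      pathQ wt B a = pfaffian (Matrix.of fun i j => pathQ wt B ![a i, a j])) := by
  refine ⟨fun i => walkQ_pair_self wt B (a i), walkQ_pair_swap wt hW hQ₂,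
    walkQ_eq_pfaffian wt hk hW hQ hQ₂, fun hV => ?_⟩
  simp only [hV.pathQ_eq_walkQ]
  exact walkQ_eq_pfaffian wt hk hW hQ hQ₂
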